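/- Let $G$ be a compact vector space over $\mathbb{F}_2$, that is, a compact Hausdorff topological abelian group in which $2x=0$ for all $x$. Let $\mu_G$ be its Haar probability measure and $\widehat{G}$ its dual group of continuous homomorphisms $\gamma: G\to\{z\in\mathbb{C}:|z|=1\}$. For $f\in L^1(G)$ put $\widehat f(\gamma)=\int_G f(x)\overline{\gamma(x)}\,d\mu_G(x)$ and $\|f\|_{A(G)}=\sum_{\gamma\in\widehat{G}}|\widehat f(\gamma)|\in[0,\infty]$. Write $\{t\}$ for the fractional part of a real number $t$, and $\chi_A$ for the indicator function of $A$. **Theorem.** For every $c>0$ there is a constant $C>0$, depending only on $c$, such that the following holds. Let $G$ be a compact vector space over $\mathbb{F}_2$, let $A\subset G$ be a $\mu_G$-measurable set of density $\alpha=\mu_G(A)$, and let $M>1$ be a real number. Suppose that every finite subgroup $V\le\widehat{G}$ with $|V|\le M$ satisfies $$\{\alpha|V|\}\,(1-\{\alpha|V|\})\ge c.$$ Then $$\|\chi_A\|_{A(G)}\ge C\log\log M.$$ -/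

import Mathlib

open MeasureTheory
open scoped ENNReal

/-- The dual group `Ĝ` of an additive topological group `G`: the continuous homomorphisms
from `G` to the unit circle, under pointwise multiplication. -/
abbrev DualGroup (G : Type*) [AddCommGroup G] [TopologicalSpace G] : Type _ :=
  PontryaginDual (Multiplicative G)

/-- The Fourier transform `f̂(γ) = ∫ f(x) conj(γ(x)) dμ(x)`. -/
noncomputable def fourierAt {G : Type*} [AddCommGroup G] [TopologicalSpace G]
    [MeasurableSpace G] (μ : Measure G) (f : G → ℂ) (γ : DualGroup G) : ℂ :=
  ∫ x, f x * (starRingEnd ℂ) ((γ (Multiplicative.ofAdd x) : Circle) : ℂ) ∂μ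

/-- The norm `‖f‖_{A(G)} = ∑_γ |f̂(γ)|`, with the value `∞` when the series diverges,
that is, when the integrable function `f` is not in `A(G)`. -/
noncomputable def algNorm {G : Type*} [AddCommGroup G] [TopologicalSpace G]
    [MeasurableSpace G] (μ : Measure G) (f : G → ℂ) : ℝ≥0∞ :=
  ∑' γ : DualGroup G, ‖fourierAt μ f γ‖ₑ

/-!
The proof enlarges a finite group `V` of characters step by step. Each step catches at least a
constant amount of the `ℓ¹` mass of the Fourier transform of `A`, and `log log |V|` grows by at most
a multiple of the mass that is caught. The steps are possible as long as `|V| ≤ M`, so the total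
mass is at least a multiple of `log log M`.

For one step, let `N = |V|`. The cosets of the annihilator `V^⊥` have measure `1 / N`, and `N α` is
the sum of the densities of `A` on them. If `N α` is not within `c` of an integer, then on one of the
`N` cosets the density is between `c / N` and `1 - c / N` (`exists_annCoset_density`). Let `B` be the
part of this coset in `A` or outside `A`, whichever is smaller. Outside `V` the Fourier
coefficients of the two parts agree up to sign, and each is an average, up to signs, of those of `A`
over a coset of `V`, so `ℓ¹` mass caught for `B` is caught for `A`
(`sum_abs_setIntegral_annCoset_le`). By Parseval's identity the squares of the coefficients of
`B` sum to `μ(B)`, and at least half of this comes from characters outside `V`. Splitting these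
coefficients dyadically according to their size relative to their upper bound `μ(B)`, one finds
`k` such that those of size at least `2 ^ (-k - 1) μ(B)` have `ℓ¹` mass at least a multiple of `k + 1`
(`exists_dyadic_layer`). By Chang's theorem (`exists_subgroup_largeSpectrum`, proved with Riesz
products) these lie in a group generated by `V` and at most a multiple of
`4 ^ k log (1 / (N μ(B))) ≤ 4 ^ k (log N + log (1 / c))` characters. So `log |V|` grows by a factor
of order `4 ^ k`, and the logarithm of this factor is paid for by the mass of order `k + 1`. That the
gain is as large as `k + 1` is what makes the bound independent of the norm itself.

Parseval's identity needs the characters to separate points, which is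
`exists_continuous_dual_ne_zero`: a compact vector space over `𝔽₂` has a basis of neighbourhoods of
`0` made of open subgroups. This is deduced from Bogolyubov's lemma on the finite subspaces by
compactness.
-/

/-! ### Bogolyubov's lemma in finite vector spaces over `𝔽₂` -/

/-- The nontrivial additive character of `ZMod 2`, with values `1` and `-1`. -/
def signTwo (a : ZMod 2) : ℝ := if a = 0 then 1 else -1

lemma signTwo_zero : signTwo 0 = 1 := by simp [signTwo]

lemma signTwo_add (a b : ZMod 2) : signTwo (a + b) = signTwo a * signTwo b := by
  have h : ∀ a : ZMod 2, a = 0 ∨ a = 1 := by decide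
  have h1 : (1 + 1 : ZMod 2) = 0 := rfl
  rcases h a with rfl | rfl <;> rcases h b with rfl | rfl <;> simp [signTwo, h1]

lemma abs_signTwo (a : ZMod 2) : |signTwo a| = 1 := by
  unfold signTwo; split_ifs <;> simp

/-- Orthogonality of the characters `signTwo ∘ φ` in the dual variable. -/
lemma sum_dual_signTwo {F : Type*} [AddCommGroup F] [Module (ZMod 2) F]
    [Fintype (Module.Dual (ZMod 2) F)] {x : F} (hx : x ≠ 0) :
    ∑ φ : Module.Dual (ZMod 2) F, signTwo (φ x) = 0 := by
  obtain ⟨ψ, hψ⟩ : ∃ ψ : Module.Dual (ZMod 2) F, ψ x ≠ 0 := by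
    by_contra! h
    exact hx ((Module.forall_dual_apply_eq_zero_iff (ZMod 2) x).1 h)
  have h1 : ∑ φ : Module.Dual (ZMod 2) F, signTwo ((ψ + φ) x)
      = ∑ φ : Module.Dual (ZMod 2) F, signTwo (φ x) :=
    Fintype.sum_equiv (Equiv.addLeft ψ) _ _ (fun _ => rfl)
  simp only [LinearMap.add_apply, signTwo_add, ← Finset.mul_sum] at h1
  have h2 : signTwo (ψ x) = -1 := by simp [signTwo, hψ]
  rw [h2] at h1
  linarith

/-- A form of Bogolyubov's lemma: if `S` has density at least `1 / m` in a finite vector space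
over `𝔽₂`, then `S + S + S + S` contains the common kernel of `2 m ^ 2` linear functionals. -/
theorem exists_dual_ker_subset_four_sum {F : Type*} [AddCommGroup F] [Module (ZMod 2) F]
    [Finite F] (S : Finset F) (m : ℕ) (h : Nat.card F ≤ m * S.card) :
    ∃ φ : Fin (2 * m ^ 2) → Module.Dual (ZMod 2) F, ∀ x, (∀ i, φ i x = 0) →
      ∃ a ∈ S, ∃ b ∈ S, ∃ c ∈ S, ∃ d ∈ S, a + b + c + d = x := by
  classical
  have : Finite (Module.Dual (ZMod 2) F) := DFunLike.finite _
  have := Fintype.ofFinite (Module.Dual (ZMod 2) F)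
  set D := Module.Dual (ZMod 2) F
  have hq : Fintype.card D = Nat.card F := by
    rw [← Nat.card_eq_fintype_card, Module.natCard_eq_pow_finrank (K := ZMod 2),
      Module.natCard_eq_pow_finrank (K := ZMod 2) (V := F), Subspace.dual_finrank_eq]
  set q : ℝ := (Fintype.card D : ℝ) with hqdef
  set s : ℝ := (S.card : ℝ) with hsdef
  have hF : 0 < Nat.card F := Nat.card_pos
  have hs : 0 < s := by
    have : 0 < S.card := by
      rcases Nat.eq_zero_or_pos S.card with h0 | h0
      · rw [h0] at h; omega
      · exact h0
    rw [hsdef]; exact_mod_cast this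
  have hq0 : 0 < q := by rw [hqdef, hq]; exact_mod_cast hF
  have hqs : q ≤ m * s := by rw [hqdef, hq, hsdef]; exact_mod_cast h
  let T : D → ℝ := fun φ => ∑ a ∈ S, signTwo (φ a)
  have hT2 : ∑ φ, T φ ^ 2 = q * s := by
    have : ∀ φ, T φ ^ 2 = ∑ a ∈ S, ∑ b ∈ S, signTwo (φ (a + b)) := by
      intro φ
      simp only [T, sq, Finset.sum_mul_sum, map_add, signTwo_add]
    simp only [this]
    rw [Finset.sum_comm]
    have h2 : ∀ a ∈ S, ∑ φ : D, ∑ b ∈ S, signTwo (φ (a + b)) = q := by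
      intro a ha
      rw [Finset.sum_comm, Finset.sum_eq_single a]
      · simp [ZModModule.add_self, signTwo_zero, hqdef]
      · intro b _ hb
        refine sum_dual_signTwo ?_
        rw [← ZModModule.sub_eq_add]
        exact sub_ne_zero.2 hb.symm
      · exact fun h => absurd ha h
    rw [Finset.sum_congr rfl h2]
    simp [hsdef, mul_comm]
  -- `R` is the large spectrum of `S`. With this threshold its complement contributes at most
  -- half of the term of the zero functional to the fourth moment below.
  set R : Finset D := Finset.univ.filter (fun φ => s ^ 3 / (2 * q) ≤ T φ ^ 2) with hR
  have hRcard : R.card ≤ 2 * m ^ 2 := by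
    have h1 : (R.card : ℝ) * (s ^ 3 / (2 * q)) ≤ q * s := by
      rw [← hT2, ← nsmul_eq_mul]
      calc _ ≤ ∑ φ ∈ R, T φ ^ 2 :=
            Finset.card_nsmul_le_sum _ _ _ (fun φ hφ => (Finset.mem_filter.1 hφ).2)
        _ ≤ _ := Finset.sum_le_sum_of_subset_of_nonneg (Finset.subset_univ _)
            (fun _ _ _ => sq_nonneg _)
    have h2 : (R.card : ℝ) * s ^ 2 ≤ 2 * q ^ 2 := by
      rw [mul_div_assoc', div_le_iff₀ (by positivity)] at h1
      have : s * (R.card * s ^ 2) ≤ s * (2 * q ^ 2) := by nlinarith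
      exact le_of_mul_le_mul_left this hs
    have h3 : q ^ 2 ≤ (m * s) ^ 2 := pow_le_pow_left₀ hq0.le hqs 2
    have h4 : (R.card : ℝ) * s ^ 2 ≤ (2 * m ^ 2) * s ^ 2 := by nlinarith
    have := le_of_mul_le_mul_right h4 (by positivity)
    exact_mod_cast this
  refine ⟨fun i => if hi : (i : ℕ) < R.card then (R.equivFin.symm ⟨i, hi⟩ : D) else 0,
    fun x hx => ?_⟩
  have hxR : ∀ φ ∈ R, φ x = 0 := by
    intro φ hφ
    have := hx ⟨R.equivFin ⟨φ, hφ⟩, lt_of_lt_of_le (Fin.is_lt _) hRcard⟩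
    simpa using this
  by_contra! hno
  -- Up to a factor, this sum counts the representations of `x` as a sum of four elements of `S`.
  have h0 : ∑ φ, T φ ^ 4 * signTwo (φ x) = 0 := by
    have : ∀ φ, T φ ^ 4 * signTwo (φ x) =
        ∑ a ∈ S, ∑ b ∈ S, ∑ c ∈ S, ∑ d ∈ S, signTwo (φ (a + b + c + d + x)) := by
      intro φ
      simp only [map_add, signTwo_add, ← Finset.sum_mul, ← Finset.mul_sum, T]
      ring
    simp only [this]
    rw [Finset.sum_comm]
    refine Finset.sum_eq_zero fun a ha => ?_
    rw [Finset.sum_comm]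
    refine Finset.sum_eq_zero fun b hb => ?_
    rw [Finset.sum_comm]
    refine Finset.sum_eq_zero fun c hc => ?_
    rw [Finset.sum_comm]
    refine Finset.sum_eq_zero fun d hd => sum_dual_signTwo ?_
    rw [← ZModModule.sub_eq_add]
    exact sub_ne_zero.2 (hno a ha b hb c hc d hd)
  have h00 : ∀ a : F, (0 : D) a = 0 := fun a => LinearMap.zero_apply a
  have hT0 : T 0 = s := by simp [T, h00, signTwo_zero, hsdef]
  have hle : ∀ φ : D, (if φ = 0 then s ^ 4 else 0) - s ^ 3 / (2 * q) * T φ ^ 2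
      ≤ T φ ^ 4 * signTwo (φ x) := by
    intro φ
    split_ifs with h0
    · subst h0
      rw [hT0]
      simp only [h00, signTwo_zero, mul_one]
      have : 0 ≤ s ^ 3 / (2 * q) * s ^ 2 := by positivity
      linarith
    · by_cases hφ : φ ∈ R
      · rw [hxR φ hφ, signTwo_zero]
        have : 0 ≤ s ^ 3 / (2 * q) * T φ ^ 2 := by positivity
        have : 0 ≤ T φ ^ 4 := by positivity
        linarith
      · have h1 : T φ ^ 2 < s ^ 3 / (2 * q) := by simpa [hR] using hφ
        have h2 : -1 ≤ signTwo (φ x) := by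
          have := abs_signTwo (φ x)
          exact (abs_le.1 this.le).1
        have h3 : T φ ^ 4 ≤ s ^ 3 / (2 * q) * T φ ^ 2 := by
          nlinarith [sq_nonneg (T φ)]
        have h4 : 0 ≤ T φ ^ 4 := by positivity
        nlinarith
  have := Finset.sum_le_sum (fun φ (_ : φ ∈ Finset.univ) => hle φ)
  rw [h0, Finset.sum_sub_distrib, ← Finset.mul_sum, hT2, Finset.sum_ite_eq'] at this
  simp only [Finset.mem_univ, if_true] at this
  have h5 : s ^ 3 / (2 * q) * (q * s) = s ^ 4 / 2 := by field_simp
  rw [h5] at this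
  have : 0 < s ^ 4 := by positivity
  linarith

/-! ### Separation of points by continuous characters -/

open Filter Topology in
/-- Continuous linear functionals separate the points of a compact vector space over `𝔽₂`.

Given a neighbourhood `N` of `0`, Bogolyubov's lemma on finite subspaces gives a number `K` that
depends on `N` only, such that on each of them some `K` linear functionals have their common kernel
inside `N`. A limit of these along an ultrafilter has a common kernel in `N` of finite index in `G`,
and the closure of that kernel is an open subgroup. -/
theorem exists_continuous_dual_ne_zero {G : Type*} [AddCommGroup G] [Module (ZMod 2) G]
    [TopologicalSpace G] [IsTopologicalAddGroup G] [CompactSpace G] [T2Space G]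
    {x : G} (hx : x ≠ 0) :
    ∃ φ : G →ₗ[ZMod 2] ZMod 2, Continuous φ ∧ φ x ≠ 0 := by
  classical
  obtain ⟨N, hN, hNc, hNx⟩ := exists_mem_nhds_isClosed_subset
    (isOpen_compl_singleton.mem_nhds (show (0 : G) ∈ ({x}ᶜ : Set G) from fun h => hx h.symm))
  obtain ⟨V₁, hV₁o, hV₁0, hV₁⟩ := exists_open_nhds_zero_half hN
  obtain ⟨V, hVo, hV0, hV⟩ := exists_open_nhds_zero_half (hV₁o.mem_nhds hV₁0)
  obtain ⟨t, ht⟩ := compact_covered_by_add_left_translates (isCompact_univ (X := G))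
    (V := V) ⟨0, by rwa [hVo.interior_eq]⟩
  set K := 2 * t.card ^ 2
  -- Some translate of `V` has density at least `1 / t.card` in the span of `E`. The translation
  -- disappears from sums of four elements, as `4 g = 0`.
  have key : ∀ E : Finset G, ∃ φ : Fin K → G →ₗ[ZMod 2] ZMod 2, ∀ y ∈ E,
      (∀ i, φ i y = 0) → y ∈ N := by
    intro E
    set W : Submodule (ZMod 2) G := Submodule.span (ZMod 2) (E : Set G)
    have : Module.Finite (ZMod 2) W := FiniteDimensional.span_finset _ _
    have : Finite W := Module.finite_of_finite (ZMod 2)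
    have := Fintype.ofFinite W
    let S : G → Finset W := fun g => Finset.univ.filter (fun y => g + (y : G) ∈ V)
    obtain ⟨g, -, hg⟩ : ∃ g ∈ t, Nat.card W ≤ t.card * (S g).card := by
      by_contra! hlt
      have hcov : (Finset.univ : Finset W) ⊆ t.biUnion S := by
        intro y _
        have := ht (Set.mem_univ (y : G))
        simpa [S] using this
      have h1 : Nat.card W ≤ ∑ g ∈ t, (S g).card := by
        rw [Nat.card_eq_fintype_card]
        exact (Finset.card_le_card hcov).trans Finset.card_biUnion_le
      have htne : t.Nonempty := by
        obtain ⟨g, hg, -⟩ := Set.mem_iUnion₂.1 (ht (Set.mem_univ (0 : G)))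
        exact ⟨g, hg⟩
      have h2 : ∑ g ∈ t, t.card * (S g).card < ∑ g ∈ t, Nat.card W :=
        Finset.sum_lt_sum_of_nonempty htne hlt
      rw [← Finset.mul_sum, Finset.sum_const, smul_eq_mul] at h2
      exact absurd (lt_of_mul_lt_mul_left h2 (Nat.zero_le _)) (not_lt.2 h1)
    obtain ⟨ψ, hψ⟩ := exists_dual_ker_subset_four_sum (S g) t.card hg
    choose φ hφ using fun i => LinearMap.exists_extend (ψ i)
    refine ⟨φ, fun y hy h0 => ?_⟩
    obtain ⟨a, ha, b, hb, c, hc, d, hd, hsum⟩ := hψ ⟨y, Submodule.subset_span hy⟩ (fun i => by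
      rw [← hφ i]; exact h0 i)
    simp only [S, Finset.mem_filter, Finset.mem_univ, true_and] at ha hb hc hd
    have := hV₁ _ (hV _ ha _ hb) _ (hV _ hc _ hd)
    have hsum' : (a + b + c + d : G) = y := congrArg Subtype.val hsum
    convert this using 1
    rw [← hsum']
    have h2 : g + g = 0 := ZModModule.add_self g
    calc (a + b + c + d : G) = (a + b + c + d : G) + (g + g) + (g + g) := by rw [h2]; simp
      _ = _ := by abel
  choose φ hφ using key
  -- A limit of the functionals along an ultrafilter finer than the directed set of finite sets.
  let 𝒰 : Ultrafilter (Finset G) := Ultrafilter.of atTop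
  let T : Finset G → Fin K → G → ZMod 2 := fun E i y => φ E i y
  obtain ⟨Φ, -, hΦ⟩ := isCompact_univ.ultrafilter_le_nhds (𝒰.map T) (by simp)
  have hlim : ∀ i y, ∀ᶠ E in (𝒰 : Filter (Finset G)), φ E i y = Φ i y := by
    intro i y
    have h1 : Tendsto T 𝒰 (𝓝 Φ) := hΦ
    have h2 : Tendsto (fun E => T E i y) 𝒰 (𝓝 (Φ i y)) :=
      tendsto_pi_nhds.1 (tendsto_pi_nhds.1 h1 i) y
    rw [nhds_discrete, tendsto_pure] at h2
    exact h2
  let Ψ : G →+ (Fin K → ZMod 2) := AddMonoidHom.mk' (fun y i => Φ i y) (by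
    intro a b
    funext i
    obtain ⟨E, h1, h2, h3⟩ := ((hlim i a).and ((hlim i b).and (hlim i (a + b)))).exists
    simp only [Pi.add_apply]
    rw [← h1, ← h2, ← h3, map_add])
  have hker : (Ψ.ker : Set G) ⊆ N := by
    intro y hy
    have hy' : ∀ i, Φ i y = 0 := fun i => congrFun (AddMonoidHom.mem_ker.1 hy) i
    have hmem : ∀ᶠ E in (𝒰 : Filter (Finset G)), y ∈ E := by
      refine Ultrafilter.of_le atTop ?_
      filter_upwards [eventually_ge_atTop {y}] with E hE
      exact hE (Finset.mem_singleton_self y)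
    obtain ⟨E, hE, h⟩ := (hmem.and (eventually_all.2 fun i => hlim i y)).exists
    exact hφ E y hE fun i => (h i).trans (hy' i)
  set P : AddSubgroup G := Ψ.ker.topologicalClosure
  have hPN : (P : Set G) ⊆ N := closure_minimal hker hNc
  have : Ψ.ker.FiniteIndex := by infer_instance
  have : P.FiniteIndex := AddSubgroup.finiteIndex_of_le Ψ.ker.le_topologicalClosure
  have hPo : IsOpen (P : Set G) :=
    P.isOpen_of_isClosed_of_finiteIndex Ψ.ker.isClosed_topologicalClosure
  have hxP : x ∉ AddSubgroup.toZModSubmodule 2 P := fun h => hNx (hPN h) rfl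
  obtain ⟨f, hfx, hf⟩ := Submodule.exists_le_ker_of_notMem hxP
  refine ⟨f, ?_, hfx⟩
  refine continuous_of_continuousAt_zero f ?_
  have : ∀ᶠ y in 𝓝 (0 : G), f y = f 0 := by
    filter_upwards [hPo.mem_nhds P.zero_mem] with y hy
    rw [map_zero]
    exact hf hy
  exact (continuousAt_const.congr (this.mono fun _ h => h.symm))

/-! ### Real characters and Parseval's identity -/

section RealCharacters

variable {G : Type*} [AddCommGroup G] [TopologicalSpace G]

/-- The real part of a character. On a vector space over `𝔽₂` all characters take the values
`1` and `-1` only, so that nothing is lost. -/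
noncomputable def realChar (γ : DualGroup G) (x : G) : ℝ :=
  ((γ (Multiplicative.ofAdd x) : Circle) : ℂ).re

lemma continuous_realChar (γ : DualGroup G) : Continuous (realChar γ) :=
  Complex.continuous_re.comp (continuous_subtype_val.comp
    ((map_continuous γ).comp continuous_ofAdd))

@[simp] lemma realChar_one (x : G) : realChar (1 : DualGroup G) x = 1 := by
  simp [realChar]

variable [Module (ZMod 2) G]

lemma ofReal_realChar (γ : DualGroup G) (x : G) :
    (realChar γ x : ℂ) = ((γ (Multiplicative.ofAdd x) : Circle) : ℂ) := by
  have h : γ (Multiplicative.ofAdd x) * γ (Multiplicative.ofAdd x) = 1 := by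
    rw [← map_mul, ← ofAdd_add, ZModModule.add_self]
    exact map_one γ
  have h2 : ((γ (Multiplicative.ofAdd x) : Circle) : ℂ) *
      ((γ (Multiplicative.ofAdd x) : Circle) : ℂ) = 1 := by
    rw [← Circle.coe_mul, h, Circle.coe_one]
  rcases mul_self_eq_one_iff.1 h2 with h3 | h3 <;> simp [realChar, h3]

lemma realChar_mul_self (γ : DualGroup G) (x : G) : realChar γ x * realChar γ x = 1 := by
  have h : γ (Multiplicative.ofAdd x) * γ (Multiplicative.ofAdd x) = 1 := by
    rw [← map_mul, ← ofAdd_add, ZModModule.add_self]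
    exact map_one γ
  have h2 := congrArg (fun z : Circle => (z : ℂ)) h
  simp only [Circle.coe_mul, Circle.coe_one, ← ofReal_realChar] at h2
  exact_mod_cast h2

lemma realChar_eq_or (γ : DualGroup G) (x : G) : realChar γ x = 1 ∨ realChar γ x = -1 :=
  mul_self_eq_one_iff.1 (realChar_mul_self γ x)

lemma abs_realChar (γ : DualGroup G) (x : G) : |realChar γ x| = 1 := by
  rcases realChar_eq_or γ x with h | h <;> simp [h]

lemma realChar_mul (γ γ' : DualGroup G) (x : G) :
    realChar (γ * γ') x = realChar γ x * realChar γ' x := by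
  have : ((γ * γ') (Multiplicative.ofAdd x) : Circle)
      = γ (Multiplicative.ofAdd x) * γ' (Multiplicative.ofAdd x) := rfl
  have h : (realChar (γ * γ') x : ℂ) = realChar γ x * realChar γ' x := by
    rw [ofReal_realChar, ofReal_realChar, ofReal_realChar, this, Circle.coe_mul]
  exact_mod_cast h

lemma realChar_add (γ : DualGroup G) (x y : G) :
    realChar γ (x + y) = realChar γ x * realChar γ y := by
  have h : (realChar γ (x + y) : ℂ) = realChar γ x * realChar γ y := by
    rw [ofReal_realChar, ofReal_realChar, ofReal_realChar, ofAdd_add, map_mul, Circle.coe_mul]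
  exact_mod_cast h

lemma dualGroup_mul_self (γ : DualGroup G) : γ * γ = 1 := by
  ext x
  have h : (realChar (γ * γ) x.toAdd : ℂ) = realChar (1 : DualGroup G) x.toAdd := by
    rw [realChar_mul, realChar_mul_self, realChar_one]
  rwa [ofReal_realChar, ofReal_realChar] at h

lemma exists_realChar_eq_neg_one {γ : DualGroup G} (hγ : γ ≠ 1) : ∃ x, realChar γ x = -1 := by
  by_contra! h
  refine hγ ?_
  ext x
  have h1 : (realChar γ x.toAdd : ℂ) = realChar (1 : DualGroup G) x.toAdd := by
    rw [(realChar_eq_or γ x.toAdd).resolve_right (h _), realChar_one]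
  rwa [ofReal_realChar, ofReal_realChar] at h1

/-- The real parts of the characters separate points. -/
lemma exists_realChar_ne_one [IsTopologicalAddGroup G] [CompactSpace G] [T2Space G] {x : G}
    (hx : x ≠ 0) : ∃ γ : DualGroup G, realChar γ x ≠ 1 := by
  obtain ⟨φ, hφ, hφx⟩ := exists_continuous_dual_ne_zero hx
  let g : Multiplicative G →ₜ* Circle :=
    { toFun := fun y => ZMod.toCircle (φ y.toAdd)
      map_one' := by simp
      map_mul' := fun a b => by simp [AddChar.map_add_eq_mul]
      continuous_toFun := by
        have : Continuous (ZMod.toCircle (N := 2)) := continuous_of_discreteTopology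
        exact this.comp (hφ.comp continuous_toAdd) }
  let γ : DualGroup G := g
  refine ⟨γ, fun h => hφx ?_⟩
  have h1 : (realChar γ x : ℂ) = 1 := by rw [h]; simp
  rw [ofReal_realChar] at h1
  have h2 : γ (Multiplicative.ofAdd x) = 1 := by
    ext
    rw [h1, Circle.coe_one]
  have h3 : ZMod.toCircle (φ x) = ZMod.toCircle (0 : ZMod 2) := by
    rw [AddChar.map_zero_eq_one]
    exact h2
  exact ZMod.injective_toCircle h3

/-- The real characters as elements of `C(G, ℝ)`. -/
noncomputable def realCharHom : DualGroup G →* C(G, ℝ) where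
  toFun γ := ⟨realChar γ, continuous_realChar γ⟩
  map_one' := by ext; simp
  map_mul' γ γ' := by ext; simp [realChar_mul]

lemma span_realCharHom_closure_eq_top [IsTopologicalAddGroup G]
    [CompactSpace G] [T2Space G] :
    (Submodule.span ℝ (Set.range (realCharHom (G := G)))).topologicalClosure = ⊤ := by
  have hsub : ((Submonoid.closure (Set.range (realCharHom (G := G))) : Submonoid C(G, ℝ)) :
      Set C(G, ℝ)) ⊆ Submodule.span ℝ (Set.range (realCharHom (G := G))) := by
    rw [← MonoidHom.coe_mrange, Submonoid.closure_eq]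
    exact Submodule.subset_span
  rw [← Algebra.adjoin_eq_span_of_subset (R := ℝ) hsub]
  have hsep : (Algebra.adjoin ℝ (Set.range (realCharHom (G := G)))).SeparatesPoints := by
    intro x y hxy
    obtain ⟨γ, hγ⟩ := exists_realChar_ne_one (sub_ne_zero.2 hxy)
    refine ⟨_, ⟨realCharHom γ, Algebra.subset_adjoin ⟨γ, rfl⟩, rfl⟩, fun h => hγ ?_⟩
    have h' : realChar γ x = realChar γ y := h
    rw [ZModModule.sub_eq_add, realChar_add, h', realChar_mul_self]
  exact congrArg Subalgebra.toSubmodule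
    (ContinuousMap.subalgebra_topologicalClosure_eq_top_of_separatesPoints _ hsep)

end RealCharacters

section Parseval

variable {G : Type*} [AddCommGroup G] [Module (ZMod 2) G] [TopologicalSpace G]
  [MeasurableSpace G] [BorelSpace G] {μ : Measure G}

lemma integrable_realChar [IsFiniteMeasure μ] (γ : DualGroup G) : Integrable (realChar γ) μ :=
  Integrable.of_bound (continuous_realChar γ).aestronglyMeasurable 1
    (Filter.Eventually.of_forall fun x => by rw [Real.norm_eq_abs, abs_realChar])

lemma integral_realChar [IsTopologicalAddGroup G] [μ.IsAddLeftInvariant] {γ : DualGroup G}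
    (hγ : γ ≠ 1) :
    ∫ x, realChar γ x ∂μ = 0 := by
  obtain ⟨y, hy⟩ := exists_realChar_eq_neg_one hγ
  have h := integral_add_left_eq_self (μ := μ) (realChar γ) y
  simp only [realChar_add, hy, neg_one_mul] at h
  rw [integral_neg] at h
  linarith

variable [IsTopologicalAddGroup G] [CompactSpace G] [IsProbabilityMeasure μ]

lemma orthonormal_realCharHom [μ.IsAddLeftInvariant] : Orthonormal ℝ
    (fun γ : DualGroup G => ContinuousMap.toLp 2 μ ℝ (realCharHom γ)) := by
  classical
  rw [orthonormal_iff_ite]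
  intro γ γ'
  rw [ContinuousMap.inner_toLp]
  have : ∀ x, (realCharHom γ' x) * (starRingEnd ℝ) (realCharHom γ x) = realChar (γ' * γ) x := by
    intro x
    rw [realChar_mul]
    rfl
  simp only [this]
  split_ifs with h
  · subst h
    simp [dualGroup_mul_self]
  · refine integral_realChar fun h1 => h ?_
    rw [← mul_left_inj γ, dualGroup_mul_self, h1]

/-- **Parseval's identity** for the indicator function of a measurable set. -/
theorem hasSum_sq_setIntegral_realChar [T2Space G] [μ.IsAddLeftInvariant] [μ.WeaklyRegular]
    {B : Set G} (hB : MeasurableSet B) :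
    HasSum (fun γ : DualGroup G => (∫ x in B, realChar γ x ∂μ) ^ 2) (μ.real B) := by
  have hspan : (Submodule.span ℝ (Set.range
      (fun γ : DualGroup G => ContinuousMap.toLp 2 μ ℝ (realCharHom γ)))).topologicalClosure
      = ⊤ := by
    convert!
      (ContinuousMap.toLp_denseRange ℝ μ ℝ (p := 2) (by simp)).topologicalClosure_map_submodule
        (span_realCharHom_closure_eq_top (G := G))
    rw [Submodule.map_span]
    congr 1
    ext; simp
  let b := HilbertBasis.mk (orthonormal_realCharHom (G := G) (μ := μ)) hspan.ge
  let g : Lp ℝ 2 μ := indicatorConstLp 2 hB (measure_ne_top μ B) (1 : ℝ)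
  have h := b.hasSum_inner_mul_inner g g
  have h1 : inner ℝ g g = μ.real B := by
    rw [L2.inner_indicatorConstLp_one]
    rw [setIntegral_congr_ae (g := fun _ => (1 : ℝ)) hB]
    · simp [measureReal_def]
    · filter_upwards [indicatorConstLp_coeFn (p := 2) (hs := hB) (hμs := measure_ne_top μ B)
        (c := (1 : ℝ))] with x hx hxB
      rw [hx]; simp [hxB]
  have h2 : ∀ γ, inner ℝ g (b γ) = ∫ x in B, realChar γ x ∂μ := by
    intro γ
    rw [L2.inner_indicatorConstLp_one, HilbertBasis.coe_mk]
    refine setIntegral_congr_ae hB ?_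
    filter_upwards [ContinuousMap.coeFn_toLp (p := 2) (𝕜 := ℝ) μ (realCharHom γ)] with x hx _
    rw [hx]; rfl
  have h3 : (fun γ => inner ℝ g (b γ) * inner ℝ (b γ) g)
      = fun γ => (∫ x in B, realChar γ x ∂μ) ^ 2 := by
    funext γ
    rw [real_inner_comm g (b γ), h2, sq]
  rw [h1, h3] at h
  exact h

end Parseval

/-! ### Cosets of annihilators and Chang's theorem -/

section Cosets

variable {G : Type*} [AddCommGroup G] [TopologicalSpace G]

/-- The coset `x + V^⊥` of the annihilator of a group `V` of characters. -/
def annCoset (V : Subgroup (DualGroup G)) (x : G) : Set G :=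
  {y | ∀ v ∈ V, realChar v y = realChar v x}

lemma isClosed_annCoset (V : Subgroup (DualGroup G)) (x : G) : IsClosed (annCoset V x) := by
  simp only [annCoset, Set.ofPred_forall]
  exact isClosed_iInter fun v => isClosed_iInter fun _ =>
    isClosed_eq (continuous_realChar v) continuous_const

variable [Module (ZMod 2) G]

/-- The Fourier expansion of the indicator function of `x + V^⊥`. -/
lemma sum_realChar_eq_indicator (V : Subgroup (DualGroup G)) [Fintype V] (x y : G) :
    (Nat.card V : ℝ)⁻¹ * ∑ v : V, realChar (v : DualGroup G) x * realChar (v : DualGroup G) y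
      = (annCoset V x).indicator 1 y := by
  by_cases hy : y ∈ annCoset V x
  · rw [Set.indicator_of_mem hy, Finset.sum_congr rfl (g := fun _ => (1 : ℝ))]
    · simp
    · intro v _
      rw [hy v v.2, realChar_mul_self]
  · rw [Set.indicator_of_notMem hy]
    simp only [annCoset, Set.mem_ofPred_eq, not_forall] at hy
    obtain ⟨v₀, hv₀, hne⟩ := hy
    have h1 : realChar v₀ x * realChar v₀ y = -1 := by
      rcases realChar_eq_or v₀ x with h | h <;> rcases realChar_eq_or v₀ y with h' | h' <;>
        simp_all
    have h2 : ∑ v : V, realChar ((⟨v₀, hv₀⟩ * v : V) : DualGroup G) x *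
          realChar ((⟨v₀, hv₀⟩ * v : V) : DualGroup G) y
        = ∑ v : V, realChar (v : DualGroup G) x * realChar (v : DualGroup G) y :=
      Fintype.sum_equiv (Equiv.mulLeft (⟨v₀, hv₀⟩ : V)) _ _ (fun _ => rfl)
    have h3 : ∀ v : V, realChar ((⟨v₀, hv₀⟩ * v : V) : DualGroup G) x *
          realChar ((⟨v₀, hv₀⟩ * v : V) : DualGroup G) y
        = -(realChar (v : DualGroup G) x * realChar (v : DualGroup G) y) := by
      intro v
      rw [Subgroup.coe_mul, realChar_mul, realChar_mul]
      linear_combination (realChar (v : DualGroup G) x * realChar (v : DualGroup G) y) * h1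
    simp only [h3, Finset.sum_neg_distrib] at h2
    have h4 : ∑ v : V, realChar (v : DualGroup G) x * realChar (v : DualGroup G) y = 0 := by
      linarith
    rw [h4, mul_zero]

/-- The group generated by `W` and a further character `l`. -/
def adjoinChar (W : Subgroup (DualGroup G)) (l : DualGroup G) : Subgroup (DualGroup G) where
  carrier := {γ | γ ∈ W ∨ l * γ ∈ W}
  one_mem' := Or.inl W.one_mem
  mul_mem' := by
    rintro a b (ha | ha) (hb | hb)
    · exact Or.inl (W.mul_mem ha hb)
    · exact Or.inr (by rw [mul_left_comm]; exact W.mul_mem ha hb)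
    · exact Or.inr (by rw [← mul_assoc]; exact W.mul_mem ha hb)
    · refine Or.inl ?_
      have := W.mul_mem ha hb
      rwa [mul_mul_mul_comm, dualGroup_mul_self, one_mul] at this
  inv_mem' := by
    intro a ha
    rwa [inv_eq_of_mul_eq_one_left (dualGroup_mul_self a)]

lemma mem_adjoinChar {W : Subgroup (DualGroup G)} {l γ : DualGroup G} :
    γ ∈ adjoinChar W l ↔ γ ∈ W ∨ l * γ ∈ W := Iff.rfl

lemma le_adjoinChar (W : Subgroup (DualGroup G)) (l : DualGroup G) : W ≤ adjoinChar W l :=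
  fun _ h => Or.inl h

lemma coe_adjoinChar (W : Subgroup (DualGroup G)) (l : DualGroup G) :
    (adjoinChar W l : Set (DualGroup G)) =
      (W : Set (DualGroup G)) ∪ (fun γ => l * γ) '' (W : Set (DualGroup G)) := by
  ext γ
  simp only [SetLike.mem_coe, mem_adjoinChar, Set.mem_union, Set.mem_image]
  refine or_congr Iff.rfl ⟨fun h => ⟨l * γ, h, ?_⟩, ?_⟩
  · rw [← mul_assoc, dualGroup_mul_self, one_mul]
  · rintro ⟨δ, hδ, rfl⟩
    rwa [← mul_assoc, dualGroup_mul_self, one_mul]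

lemma finite_adjoinChar (W : Subgroup (DualGroup G)) [Finite W] (l : DualGroup G) :
    Finite (adjoinChar W l) := by
  have hW : (W : Set (DualGroup G)).Finite := Set.toFinite _
  have : (adjoinChar W l : Set (DualGroup G)).Finite := by
    rw [coe_adjoinChar]
    exact hW.union (hW.image _)
  exact this

lemma card_adjoinChar_le (W : Subgroup (DualGroup G)) (l : DualGroup G) [Finite W] :
    Nat.card (adjoinChar W l) ≤ Nat.card W * 2 := by
  have h1 : Nat.card (adjoinChar W l) = (adjoinChar W l : Set (DualGroup G)).ncard := rfl
  have h2 : Nat.card W = (W : Set (DualGroup G)).ncard := rfl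
  rw [h1, h2, coe_adjoinChar, mul_two]
  exact (Set.ncard_union_le _ _).trans
    (Nat.add_le_add_left (Set.ncard_image_le (Set.toFinite _)) _)

variable [MeasurableSpace G] [BorelSpace G] {μ : Measure G}

lemma setIntegral_annCoset [IsFiniteMeasure μ] (V : Subgroup (DualGroup G)) [Fintype V] (x : G)
    (γ : DualGroup G) (A : Set G) :
    ∫ y in A ∩ annCoset V x, realChar γ y ∂μ = (Nat.card V : ℝ)⁻¹ *
      ∑ v : V, realChar (v : DualGroup G) x * ∫ y in A, realChar ((v : DualGroup G) * γ) y ∂μ := by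
  rw [← setIntegral_indicator (isClosed_annCoset V x).measurableSet]
  have h : ∀ y, (annCoset V x).indicator (realChar γ) y = (Nat.card V : ℝ)⁻¹ *
      ∑ v : V, realChar (v : DualGroup G) x * realChar ((v : DualGroup G) * γ) y := by
    intro y
    have h1 := sum_realChar_eq_indicator V x y
    have h2 : (annCoset V x).indicator (realChar γ) y
        = (annCoset V x).indicator 1 y * realChar γ y := by
      by_cases hy : y ∈ annCoset V x <;> simp [hy]
    rw [h2, ← h1, mul_assoc, Finset.sum_mul]
    simp only [realChar_mul, mul_assoc]
  simp only [h]
  rw [integral_const_mul, integral_finsetSum _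
    (fun v _ => ((integrable_realChar _).const_mul _))]
  simp only [integral_const_mul]

variable [IsTopologicalAddGroup G] [IsProbabilityMeasure μ] [μ.IsAddLeftInvariant]

lemma integral_annCoset_of_notMem {V : Subgroup (DualGroup G)} [Finite V] (x : G)
    {γ : DualGroup G} (hγ : γ ∉ V) : ∫ y in annCoset V x, realChar γ y ∂μ = 0 := by
  have := Fintype.ofFinite V
  rw [← Set.univ_inter (annCoset V x), setIntegral_annCoset, Finset.sum_eq_zero, mul_zero]
  intro v _
  rw [setIntegral_univ, integral_realChar, mul_zero]
  intro h
  refine hγ ?_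
  exact eq_inv_of_mul_eq_one_right h ▸ V.inv_mem v.2

lemma measureReal_annCoset (V : Subgroup (DualGroup G)) [Finite V] (x : G) :
    μ.real (annCoset V x) = (Nat.card V : ℝ)⁻¹ := by
  classical
  have := Fintype.ofFinite V
  have h := setIntegral_annCoset (μ := μ) V x 1 Set.univ
  have h1 : ∀ v : V, v ≠ 1 → realChar (v : DualGroup G) x *
      ∫ y in Set.univ, realChar ((v : DualGroup G) * 1) y ∂μ = 0 := by
    intro v hv
    rw [mul_one, setIntegral_univ, integral_realChar (by simpa using hv), mul_zero]
  rw [Fintype.sum_eq_single 1 h1] at h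
  simpa using h

/-- Outside `V`, replacing `A` by its complement within a coset of `V^⊥` does not change the size
of the Fourier coefficients. -/
lemma abs_setIntegral_annCoset_diff {V : Subgroup (DualGroup G)} [Finite V] (x : G)
    {γ : DualGroup G} (hγ : γ ∉ V) {A : Set G} (hA : MeasurableSet A) :
    |∫ y in annCoset V x \ A, realChar γ y ∂μ| = |∫ y in A ∩ annCoset V x, realChar γ y ∂μ| := by
  have h := integral_inter_add_sdiff (μ := μ) (s := annCoset V x) hA
    (integrable_realChar γ).integrableOn
  rw [integral_annCoset_of_notMem x hγ, Set.inter_comm] at h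
  rw [← abs_neg]
  congr 1
  linarith

end Cosets

section LargeSpectrum

lemma exp_mul_eq_cosh_add {u : ℝ} (hu : u = 1 ∨ u = -1) (t : ℝ) :
    Real.exp (t * u) = Real.cosh t + u * Real.sinh t := by
  rcases hu with rfl | rfl
  · rw [mul_one, one_mul, Real.cosh_add_sinh]
  · rw [mul_neg_one, neg_one_mul, ← sub_eq_add_neg, Real.cosh_sub_sinh]

variable {G : Type*} [AddCommGroup G] [TopologicalSpace G]
  [MeasurableSpace G] [BorelSpace G] {μ : Measure G} [IsProbabilityMeasure μ]

/-- A Riesz product for `B ⊆ x + V^⊥`: the density `E` restricted to `x + V^⊥` is the product of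
the factors `exp (± ε λ)` over `n` characters `λ` that are independent modulo `V`, each with
`|∫_B λ| ≥ ε μ(B)`; the Fourier transform of `E` lives on the span `W` of `V` and these
characters. The function `L` is the exponent. The characters and the signs themselves are not
recorded, only the consequences of their choice that are used. -/
structure RieszProduct (μ : Measure G) (V : Subgroup (DualGroup G)) (x : G) (B : Set G) (ε : ℝ)
    (n : ℕ) (W : Subgroup (DualGroup G)) (E L : G → ℝ) : Prop where
  le : V ≤ W
  finite : Finite W
  card_le : Nat.card W ≤ Nat.card V * 2 ^ n
  continuous_density : Continuous E
  continuous_exponent : Continuous L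
  nonneg : ∀ y, 0 ≤ E y
  eq_exp : ∀ y ∈ annCoset V x, E y = Real.exp (L y)
  integral_eq_zero : ∀ γ ∉ W, ∫ y, E y * realChar γ y ∂μ = 0
  integral_eq : ∫ y, E y ∂μ = (Nat.card V : ℝ)⁻¹ * Real.cosh ε ^ n
  le_setIntegral : n * ε ^ 2 * μ.real B ≤ ∫ y in B, L y ∂μ

/-- Jensen's inequality bounds the number of factors of a Riesz product. -/
lemma RieszProduct.mul_sq_le [CompactSpace G] {V : Subgroup (DualGroup G)} {x : G}
    {B : Set G} {ε : ℝ} {n : ℕ} {W : Subgroup (DualGroup G)} {E L : G → ℝ}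
    (h : RieszProduct μ V x B ε n W E L) [Finite V] (hB : MeasurableSet B) (hBV : B ⊆ annCoset V x) (hB0 : 0 < μ.real B) :
    n * ε ^ 2 ≤ 2 * Real.log (1 / (Nat.card V * μ.real B)) := by
  have hN : (0 : ℝ) < Nat.card V := by exact_mod_cast Nat.card_pos
  set a : ℝ := n * ε ^ 2 with ha
  have hE : Integrable E μ := h.continuous_density.integrable_of_hasCompactSupport
    (HasCompactSupport.of_compactSpace _)
  have hL : Integrable L μ := h.continuous_exponent.integrable_of_hasCompactSupport
    (HasCompactSupport.of_compactSpace _)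
  -- The tangent line of `exp` at `a`, the lower bound for the average of `L` over `B`.
  have h1 : ∫ y in B, Real.exp a * (1 + (L y - a)) ∂μ ≤ ∫ y in B, E y ∂μ := by
    refine setIntegral_mono_on ?_ hE.integrableOn hB ?_
    · exact (((integrable_const _).add (hL.sub (integrable_const _))).const_mul _).integrableOn
    · intro y hy
      rw [h.eq_exp y (hBV hy)]
      have h2 := Real.add_one_le_exp (L y - a)
      calc Real.exp a * (1 + (L y - a)) ≤ Real.exp a * Real.exp (L y - a) := by
            refine mul_le_mul_of_nonneg_left ?_ (Real.exp_nonneg _)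
            linarith
        _ = _ := by rw [← Real.exp_add]; congr 1; ring
  have h2 : ∫ y in B, E y ∂μ ≤ ∫ y, E y ∂μ :=
    setIntegral_le_integral hE (Filter.Eventually.of_forall h.nonneg)
  have h3 : ∫ y in B, Real.exp a * (1 + (L y - a)) ∂μ
      = Real.exp a * (μ.real B + (∫ y in B, L y ∂μ - a * μ.real B)) := by
    have h4 : ∀ y, Real.exp a * (1 + (L y - a)) = Real.exp a * L y + Real.exp a * (1 - a) :=
      fun y => by ring
    simp only [h4]
    rw [integral_add (hL.integrableOn.const_mul _) (integrable_const _), integral_const_mul,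
      setIntegral_const, smul_eq_mul]
    ring
  have h4 : Real.exp a * μ.real B ≤ (Nat.card V : ℝ)⁻¹ * Real.exp (a / 2) := by
    calc Real.exp a * μ.real B
        ≤ Real.exp a * (μ.real B + (∫ y in B, L y ∂μ - a * μ.real B)) := by
          refine mul_le_mul_of_nonneg_left ?_ (Real.exp_nonneg _)
          have := h.le_setIntegral
          linarith
      _ ≤ (Nat.card V : ℝ)⁻¹ * Real.cosh ε ^ n := by
          rw [← h.integral_eq, ← h3]; exact h1.trans h2
      _ ≤ _ := by
          refine mul_le_mul_of_nonneg_left ?_ (by positivity)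
          calc Real.cosh ε ^ n ≤ Real.exp (ε ^ 2 / 2) ^ n :=
                pow_le_pow_left₀ (Real.cosh_pos _).le (Real.cosh_le_exp_half_sq _) _
            _ = _ := by rw [← Real.exp_nat_mul]; congr 1; rw [ha]; ring
  have h5 : Real.exp (a / 2) ≤ 1 / (Nat.card V * μ.real B) := by
    have h6 : Real.exp a = Real.exp (a / 2) * Real.exp (a / 2) := by
      rw [← Real.exp_add]; congr 1; ring
    rw [le_div_iff₀ (by positivity)]
    have h7 := mul_le_mul_of_nonneg_left h4 hN.le
    rw [mul_inv_cancel_left₀ hN.ne', h6] at h7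
    have h8 := Real.exp_pos (a / 2)
    refine le_of_mul_le_mul_left (?_ : Real.exp (a / 2) * _ ≤ Real.exp (a / 2) * 1) h8
    linarith
  have h9 := (Real.le_log_iff_exp_le (by positivity)).2 h5
  linarith

variable [Module (ZMod 2) G]

lemma rieszProduct_zero [IsTopologicalAddGroup G] [μ.IsAddLeftInvariant]
    (V : Subgroup (DualGroup G)) [Finite V] (x : G) (B : Set G) (ε : ℝ) :
    ∃ E L, RieszProduct μ V x B ε 0 V E L := by
  have := Fintype.ofFinite V
  have hE : ∀ y, (Nat.card V : ℝ)⁻¹ * ∑ v : V, realChar (v : DualGroup G) x *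
      realChar (v : DualGroup G) y = (annCoset V x).indicator 1 y :=
    sum_realChar_eq_indicator V x
  have hint : ∀ γ, ∫ y, (annCoset V x).indicator 1 y * realChar γ y ∂μ
      = ∫ y in annCoset V x, realChar γ y ∂μ := by
    intro γ
    rw [← integral_indicator (isClosed_annCoset V x).measurableSet]
    congr 1
    ext y
    by_cases hy : y ∈ annCoset V x <;> simp [hy]
  refine ⟨(annCoset V x).indicator 1, 0, le_rfl, inferInstance, by simp, ?_, continuous_const,
    ?_, ?_, ?_, ?_, by simp⟩
  · rw [← funext hE]
    exact continuous_const.mul (continuous_finsetSum _ fun v _ =>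
      continuous_const.mul (continuous_realChar _))
  · exact fun y => Set.indicator_nonneg (fun _ _ => zero_le_one) y
  · intro y hy
    simp [hy]
  · intro γ hγ
    rw [hint, integral_annCoset_of_notMem x hγ]
  · rw [pow_zero, mul_one, ← measureReal_annCoset (μ := μ) V x]
    rw [integral_indicator_one (isClosed_annCoset V x).measurableSet]

variable [CompactSpace G]

/-- A Riesz product is extended by a factor for any large Fourier coefficient outside its span.
As a character `l` takes the values `1` and `-1` only, `exp (± ε l)` is
`cosh ε ± l sinh ε`, and `l ∉ W` makes the second term integrate to zero. -/
lemma RieszProduct.succ {V : Subgroup (DualGroup G)} {x : G} {B : Set G} {ε : ℝ} {n : ℕ}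
    {W : Subgroup (DualGroup G)} {E L : G → ℝ} (h : RieszProduct μ V x B ε n W E L)
    (hε : 0 ≤ ε) {l : DualGroup G}
    (hlW : l ∉ W) (hl : ε * μ.real B ≤ |∫ y in B, realChar l y ∂μ|) :
    ∃ E' L', RieszProduct μ V x B ε (n + 1) (adjoinChar W l) E' L' := by
  have := h.finite
  obtain ⟨s, hs, hsl⟩ : ∃ s : ℝ, (s = 1 ∨ s = -1) ∧
      s * ∫ y in B, realChar l y ∂μ = |∫ y in B, realChar l y ∂μ| := by
    rcases abs_choice (∫ y in B, realChar l y ∂μ) with h | h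
    · exact ⟨1, Or.inl rfl, by rw [h, one_mul]⟩
    · exact ⟨-1, Or.inr rfl, by rw [h, neg_one_mul]⟩
  have hexp : ∀ y, Real.exp (ε * (s * realChar l y))
      = Real.cosh ε + s * realChar l y * Real.sinh ε := by
    intro y
    refine exp_mul_eq_cosh_add ?_ ε
    rcases hs with rfl | rfl <;> rcases realChar_eq_or l y with h | h <;> simp [h]
  have hint : ∀ γ, Integrable (fun y => E y * realChar γ y) μ := fun γ =>
    (h.continuous_density.mul (continuous_realChar γ)).integrable_of_hasCompactSupport
      (HasCompactSupport.of_compactSpace _)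
  have hE' : ∀ γ, ∫ y, (E y * Real.exp (ε * (s * realChar l y))) * realChar γ y ∂μ
      = Real.cosh ε * ∫ y, E y * realChar γ y ∂μ
        + s * Real.sinh ε * ∫ y, E y * realChar (l * γ) y ∂μ := by
    intro γ
    rw [← integral_const_mul, ← integral_const_mul,
      ← integral_add ((hint γ).const_mul _) ((hint _).const_mul _)]
    congr 1
    ext y
    rw [hexp, realChar_mul]
    ring
  refine ⟨fun y => E y * Real.exp (ε * (s * realChar l y)),
    fun y => L y + ε * (s * realChar l y), h.le.trans (le_adjoinChar W l),
    finite_adjoinChar W l, ?_, ?_, ?_, ?_, ?_, ?_, ?_, ?_⟩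
  · calc _ ≤ Nat.card W * 2 := card_adjoinChar_le W l
      _ ≤ (Nat.card V * 2 ^ n) * 2 := Nat.mul_le_mul_right _ h.card_le
      _ = _ := by ring
  · exact h.continuous_density.mul (Real.continuous_exp.comp
      (continuous_const.mul (continuous_const.mul (continuous_realChar l))))
  · exact h.continuous_exponent.add
      (continuous_const.mul (continuous_const.mul (continuous_realChar l)))
  · exact fun y => mul_nonneg (h.nonneg y) (Real.exp_nonneg _)
  · intro y hy
    rw [h.eq_exp y hy, ← Real.exp_add]
  · intro γ hγ
    rw [mem_adjoinChar, not_or] at hγ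
    rw [hE', h.integral_eq_zero γ hγ.1, h.integral_eq_zero _ hγ.2]
    simp
  · have h1 := hE' 1
    simp only [realChar_one, mul_one] at h1
    rw [h1, h.integral_eq, h.integral_eq_zero l hlW]
    ring
  · have hL : Integrable L μ := h.continuous_exponent.integrable_of_hasCompactSupport
      (HasCompactSupport.of_compactSpace _)
    rw [integral_add hL.integrableOn
      (((integrable_realChar l).const_mul _).const_mul _).integrableOn,
      integral_const_mul, integral_const_mul, hsl]
    have h1 := h.le_setIntegral
    have h2 := mul_le_mul_of_nonneg_left hl hε
    push_cast
    nlinarith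

/-- **Chang's theorem** relative to a coset of `V^⊥`: the characters `γ` with
`|∫_B γ| ≥ ε μ(B)` lie in a group generated by `V` and at most `2 ε⁻² log (1 / (|V| μ(B)))`
further characters. -/
theorem exists_subgroup_largeSpectrum [IsTopologicalAddGroup G] [μ.IsAddLeftInvariant]
    (V : Subgroup (DualGroup G)) [Finite V] {x : G} {B : Set G}
    (hB : MeasurableSet B) (hBV : B ⊆ annCoset V x) (hB0 : 0 < μ.real B) {ε : ℝ} (hε : 0 < ε) :
    ∃ (W : Subgroup (DualGroup G)) (n : ℕ), V ≤ W ∧ Finite W ∧ Nat.card W ≤ Nat.card V * 2 ^ n ∧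
      n * ε ^ 2 ≤ 2 * Real.log (1 / (Nat.card V * μ.real B)) ∧
      ∀ γ, ε * μ.real B ≤ |∫ y in B, realChar γ y ∂μ| → γ ∈ W := by
  by_contra! hno
  have key : ∀ n : ℕ, ∃ W E L, RieszProduct μ V x B ε n W E L := by
    intro n
    induction n with
    | zero => exact ⟨V, rieszProduct_zero V x B ε⟩
    | succ n ih =>
      obtain ⟨W, E, L, h⟩ := ih
      obtain ⟨l, hl, hlW⟩ := hno W n h.le h.finite h.card_le (h.mul_sq_le hB hBV hB0)
      exact ⟨_, h.succ hε.le hlW hl⟩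
  obtain ⟨n, hn⟩ := exists_nat_gt (2 * Real.log (1 / (Nat.card V * μ.real B)) / ε ^ 2)
  obtain ⟨W, E, L, h⟩ := key n
  rw [div_lt_iff₀ (by positivity)] at hn
  exact absurd (h.mul_sq_le hB hBV hB0) (not_le.2 hn)

end LargeSpectrum

/-! ### Enlarging a group of characters to catch Fourier mass -/

section WeightGain

lemma sum_range_succ_div_two_pow_le (n : ℕ) :
    ∑ k ∈ Finset.range n, ((k : ℝ) + 1) / 2 ^ k ≤ 4 := by
  have h : ∑ k ∈ Finset.range n, ((k : ℝ) + 1) / 2 ^ k = 4 - (2 * n + 4) / 2 ^ n := by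
    induction n with
    | zero => norm_num
    | succ n ih =>
      rw [Finset.sum_range_succ, ih, pow_succ]
      push_cast
      field_simp
      ring
  rw [h]
  have : (0 : ℝ) ≤ (2 * n + 4) / 2 ^ n := by positivity
  linarith

/-- If the numbers `b i ≤ β` have `∑ b i ^ 2 > β / 4`, then for some `k` those of size at least
`β / 2 ^ (k + 1)` have a sum of order at least `k + 1`: the weights `2 ^ (-k)` in the sum of
squares decay faster than `k + 1` grows. -/
lemma exists_dyadic_layer {ι : Type*} {Q : Finset ι} {b : ι → ℝ} {β : ℝ}
    (hb0 : ∀ i ∈ Q, 0 < b i) (hb : ∀ i ∈ Q, b i ≤ β) (hβ : 0 < β)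
    (hsum : β / 4 < ∑ i ∈ Q, b i ^ 2) :
    ∃ k : ℕ, ((k : ℝ) + 1) / 16 ≤ ∑ i ∈ Q with β / 2 ^ (k + 1) ≤ b i, b i := by
  classical
  by_contra! hno
  have hex : ∀ i ∈ Q, ∃ k : ℕ, β / 2 ^ (k + 1) ≤ b i ∧ b i ≤ β / 2 ^ k := by
    intro i hi
    obtain ⟨k, h1, h2⟩ := exists_nat_pow_near ((one_le_div (hb0 i hi)).2 (hb i hi))
      (one_lt_two (α := ℝ))
    refine ⟨k, ?_, ?_⟩
    · rw [div_lt_iff₀ (hb0 i hi)] at h2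
      rw [div_le_iff₀ (by positivity)]
      linarith
    · rw [le_div_iff₀ (hb0 i hi)] at h1
      rw [le_div_iff₀ (by positivity)]
      linarith
  choose! κ hκ using hex
  obtain ⟨n, hn⟩ : ∃ n, ∀ i ∈ Q, κ i < n :=
    ⟨Q.sup κ + 1, fun i hi => Nat.lt_succ_of_le (Finset.le_sup hi)⟩
  have h1 : ∑ i ∈ Q, b i ^ 2 = ∑ k ∈ Finset.range n, ∑ i ∈ Q with κ i = k, b i ^ 2 :=
    (Finset.sum_fiberwise_of_maps_to (fun i hi => Finset.mem_range.2 (hn i hi)) _).symm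
  have h2 : ∀ k ∈ Finset.range n, ∑ i ∈ Q with κ i = k, b i ^ 2
      ≤ β / 16 * (((k : ℝ) + 1) / 2 ^ k) := by
    intro k _
    calc ∑ i ∈ Q with κ i = k, b i ^ 2 ≤ ∑ i ∈ Q with κ i = k, β / 2 ^ k * b i := by
          refine Finset.sum_le_sum fun i hi => ?_
          rw [Finset.mem_filter] at hi
          rw [sq]
          refine mul_le_mul_of_nonneg_right ?_ (hb0 i hi.1).le
          rw [← hi.2]
          exact (hκ i hi.1).2
      _ = β / 2 ^ k * ∑ i ∈ Q with κ i = k, b i := by rw [Finset.mul_sum]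
      _ ≤ β / 2 ^ k * ∑ i ∈ Q with β / 2 ^ (k + 1) ≤ b i, b i := by
          refine mul_le_mul_of_nonneg_left ?_ (by positivity)
          refine Finset.sum_le_sum_of_subset_of_nonneg ?_ ?_
          · intro i hi
            rw [Finset.mem_filter] at hi ⊢
            refine ⟨hi.1, ?_⟩
            rw [← hi.2]
            exact (hκ i hi.1).1
          · exact fun i hi _ => (hb0 i (Finset.mem_filter.1 hi).1).le
      _ ≤ β / 2 ^ k * (((k : ℝ) + 1) / 16) :=
          mul_le_mul_of_nonneg_left (hno k).le (by positivity)
      _ = _ := by ring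
  have h3 := Finset.sum_le_sum h2
  rw [← h1, ← Finset.mul_sum] at h3
  have h4 := mul_le_mul_of_nonneg_left (sum_range_succ_div_two_pow_le n)
    (show 0 ≤ β / 16 by positivity)
  linarith

variable {G : Type*} [AddCommGroup G] [TopologicalSpace G] [Module (ZMod 2) G]
  [MeasurableSpace G] {μ : Measure G} [IsProbabilityMeasure μ]

lemma abs_setIntegral_realChar_le (γ : DualGroup G) (B : Set G) :
    |∫ y in B, realChar γ y ∂μ| ≤ μ.real B := by
  have := norm_setIntegral_le_of_norm_le_const (μ := μ) (s := B) (f := realChar γ) (C := 1)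
    (measure_lt_top μ B) (fun y _ => by rw [Real.norm_eq_abs, abs_realChar])
  simpa using this

variable [BorelSpace G]

/-- Restriction to a coset of `V^⊥` does not increase the `ℓ¹` norm of the Fourier transform
over a finite union of cosets of `V`. -/
lemma sum_abs_setIntegral_annCoset_le {V W : Subgroup (DualGroup G)} [Finite V] (hVW : V ≤ W)
    (x : G) (A : Set G) {T : Finset (DualGroup G)} (hT : ∀ γ, γ ∈ T ↔ γ ∈ W ∧ γ ∉ V) :
    ∑ γ ∈ T, |∫ y in A ∩ annCoset V x, realChar γ y ∂μ|
      ≤ ∑ γ ∈ T, |∫ y in A, realChar γ y ∂μ| := by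
  have := Fintype.ofFinite V
  have hN : (0 : ℝ) < Nat.card V := by exact_mod_cast Nat.card_pos
  have h1 : ∀ γ ∈ T, |∫ y in A ∩ annCoset V x, realChar γ y ∂μ| ≤ (Nat.card V : ℝ)⁻¹ *
      ∑ v : V, |∫ y in A, realChar ((v : DualGroup G) * γ) y ∂μ| := by
    intro γ _
    rw [setIntegral_annCoset, abs_mul, abs_of_pos (inv_pos.2 hN)]
    refine mul_le_mul_of_nonneg_left ?_ (inv_pos.2 hN).le
    refine (Finset.abs_sum_le_sum_abs _ _).trans (Finset.sum_le_sum fun v _ => ?_)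
    rw [abs_mul, abs_realChar, one_mul]
  refine (Finset.sum_le_sum h1).trans ?_
  rw [← Finset.mul_sum, Finset.sum_comm]
  have h2 : ∀ v : V, ∑ γ ∈ T, |∫ y in A, realChar ((v : DualGroup G) * γ) y ∂μ|
      = ∑ γ ∈ T, |∫ y in A, realChar γ y ∂μ| := by
    intro v
    have hmem : ∀ γ ∈ T, (v : DualGroup G) * γ ∈ T := by
      intro γ hγ
      rw [hT] at hγ ⊢
      exact ⟨W.mul_mem (hVW v.2) hγ.1, fun h => hγ.2 ((V.mul_mem_cancel_left v.2).1 h)⟩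
    refine Finset.sum_bij' (fun γ _ => v * γ) (fun γ _ => v * γ) hmem hmem ?_ ?_ ?_
    · intro γ _
      rw [← mul_assoc, dualGroup_mul_self, one_mul]
    · intro γ _
      rw [← mul_assoc, dualGroup_mul_self, one_mul]
    · intro γ _
      rfl
  simp only [h2]
  simp only [Finset.sum_const, Finset.card_univ, nsmul_eq_mul, ← Nat.card_eq_fintype_card]
  rw [inv_mul_cancel_left₀ hN.ne']

variable [IsTopologicalAddGroup G] [CompactSpace G] [T2Space G] [μ.IsAddLeftInvariant]
  [μ.WeaklyRegular]

/-- If `A` neither fills nor misses a coset of `V^⊥`, then `V` can be enlarged so that the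
`ℓ¹` norm of the Fourier transform of `A` grows by a multiple of `k + 1`, while the dimension
grows by a factor exponential in `k`. The set `B` is the part of `A` in the coset, or the part
of the complement, whichever is smaller. -/
theorem exists_subgroup_weight_gain (V : Subgroup (DualGroup G)) [Finite V] {x : G} {A B : Set G}
    (hA : MeasurableSet A) (hB : B = A ∩ annCoset V x ∨ B = annCoset V x \ A)
    (hB0 : 0 < μ.real B) (hB1 : Nat.card V * μ.real B ≤ 1 / 2) :
    ∃ (k n : ℕ) (W : Subgroup (DualGroup G)), V ≤ W ∧ Finite W ∧
      Nat.card W ≤ Nat.card V * 2 ^ n ∧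
      n ≤ 2 * 4 ^ (k + 1) * Real.log (1 / (Nat.card V * μ.real B)) ∧
      ∀ T : Finset (DualGroup G), (∀ γ, γ ∈ T ↔ γ ∈ W ∧ γ ∉ V) →
        ((k : ℝ) + 1) / 16 ≤ ∑ γ ∈ T, |∫ y in A, realChar γ y ∂μ| := by
  classical
  have hcoset := (isClosed_annCoset V x).measurableSet
  have hBm : MeasurableSet B := by
    rcases hB with rfl | rfl
    · exact hA.inter hcoset
    · exact hcoset.diff hA
  have hBV : B ⊆ annCoset V x := by
    rcases hB with rfl | rfl
    · exact Set.inter_subset_right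
    · exact Set.sdiff_subset
  have hBA : ∀ γ ∉ V, |∫ y in B, realChar γ y ∂μ|
      = |∫ y in A ∩ annCoset V x, realChar γ y ∂μ| := by
    intro γ hγ
    rcases hB with rfl | rfl
    · rfl
    · exact abs_setIntegral_annCoset_diff x hγ hA
  set β := μ.real B with hβ
  let f : DualGroup G → ℝ := fun γ => |∫ y in B, realChar γ y ∂μ|
  have hf0 : ∀ γ, 0 ≤ f γ := fun γ => abs_nonneg _
  have hfβ : ∀ γ, f γ ≤ β := fun γ => abs_setIntegral_realChar_le γ B
  have hsum : HasSum (fun γ => f γ ^ 2) β := by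
    simpa only [f, sq_abs] using hasSum_sq_setIntegral_realChar (μ := μ) hBm
  have hVfin : (V : Set (DualGroup G)).Finite := Set.toFinite _
  -- The coefficients in `V` have at most half of the mass in Parseval's identity.
  obtain ⟨Q', hQ'⟩ := (hsum.eventually (lt_mem_nhds (show β - β / 4 < β by linarith))).exists
  have hsplit : ∑ γ ∈ Q', f γ ^ 2
      ≤ ∑ γ ∈ Q' with γ ∉ V, f γ ^ 2 + Nat.card V * β ^ 2 := by
    rw [← Finset.sum_filter_add_sum_filter_not Q' (fun γ => γ ∉ V)]
    refine add_le_add le_rfl ?_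
    have hsub : (Q'.filter fun γ => ¬ γ ∉ V) ⊆ hVfin.toFinset := by
      intro γ hγ
      have := (Finset.mem_filter.1 hγ).2
      rw [not_not] at this
      simpa using this
    have hcard : hVfin.toFinset.card = Nat.card V := by
      rw [← Set.ncard_eq_toFinset_card _ hVfin]; rfl
    calc _ ≤ ∑ γ ∈ hVfin.toFinset, f γ ^ 2 :=
          Finset.sum_le_sum_of_subset_of_nonneg hsub fun _ _ _ => sq_nonneg _
      _ ≤ ∑ _γ ∈ hVfin.toFinset, β ^ 2 :=
          Finset.sum_le_sum fun γ _ => pow_le_pow_left₀ (hf0 γ) (hfβ γ) 2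
      _ = _ := by rw [Finset.sum_const, hcard, nsmul_eq_mul]
  set Q := (Q'.filter fun γ => γ ∉ V).filter fun γ => f γ ^ 2 ≠ 0 with hQdef
  have hQ : β / 4 < ∑ γ ∈ Q, f γ ^ 2 := by
    rw [hQdef, Finset.sum_filter_ne_zero]
    have : Nat.card V * β ^ 2 ≤ 1 / 2 * β := by
      rw [sq, ← mul_assoc]
      exact mul_le_mul_of_nonneg_right hB1 hB0.le
    linarith
  have hQV : ∀ γ ∈ Q, γ ∉ V := fun γ hγ =>
    (Finset.mem_filter.1 (Finset.mem_filter.1 hγ).1).2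
  obtain ⟨k, hk⟩ := exists_dyadic_layer (Q := Q) (b := f) (β := β)
    (fun γ hγ => lt_of_le_of_ne (hf0 γ) fun h => (Finset.mem_filter.1 hγ).2 (by rw [← h]; simp))
    (fun γ _ => hfβ γ) hB0 hQ
  obtain ⟨W, n, hVW, hWfin, hcard, hn, hW⟩ := exists_subgroup_largeSpectrum V hBm hBV hB0
    (ε := 1 / 2 ^ (k + 1)) (by positivity)
  refine ⟨k, n, W, hVW, hWfin, hcard, ?_, fun T hT => ?_⟩
  · have h4 : ((1 : ℝ) / 2 ^ (k + 1)) ^ 2 = 1 / 4 ^ (k + 1) := by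
      rw [div_pow, one_pow, ← pow_mul, mul_comm, pow_mul]; norm_num
    rw [h4, mul_one_div, div_le_iff₀ (by positivity)] at hn
    linarith
  · calc ((k : ℝ) + 1) / 16 ≤ ∑ γ ∈ Q with β / 2 ^ (k + 1) ≤ f γ, f γ := hk
      _ ≤ ∑ γ ∈ T, f γ := by
          refine Finset.sum_le_sum_of_subset_of_nonneg ?_ fun γ _ _ => hf0 γ
          intro γ hγ
          rw [Finset.mem_filter] at hγ
          refine (hT γ).2 ⟨hW γ ?_, hQV γ hγ.1⟩
          rw [one_div_mul_eq_div]
          exact hγ.2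
      _ = ∑ γ ∈ T, |∫ y in A ∩ annCoset V x, realChar γ y ∂μ| :=
          Finset.sum_congr rfl fun γ hγ => hBA γ ((hT γ).1 hγ).2
      _ ≤ _ := sum_abs_setIntegral_annCoset_le hVW x A hT

end WeightGain

/-! ### Density of a set on cosets -/

section CosetDensity

lemma fract_mul_one_sub_fract_le (y : ℝ) (z : ℤ) :
    Int.fract y * (1 - Int.fract y) ≤ |y - z| := by
  have h0 := Int.fract_nonneg y
  have h1 := (Int.fract_lt_one y).le
  have h2 := Int.self_sub_floor y
  rcases le_or_gt z ⌊y⌋ with h | h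
  · have h3 : (z : ℝ) ≤ ⌊y⌋ := by exact_mod_cast h
    have h4 := le_abs_self (y - z)
    nlinarith
  · have h3 : (⌊y⌋ : ℝ) + 1 ≤ z := by exact_mod_cast h
    have h4 := neg_abs_le (y - z)
    nlinarith

variable {G : Type*} [AddCommGroup G] [TopologicalSpace G] [Module (ZMod 2) G]
  [MeasurableSpace G] [BorelSpace G] {μ : Measure G} [IsProbabilityMeasure μ]
  [IsTopologicalAddGroup G] [μ.IsAddLeftInvariant]

/-- If `|V| μ(A)` is not close to an integer, then the density of `A` on some coset of `V^⊥` is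
not close to `0` or `1`. -/
theorem exists_annCoset_density (V : Subgroup (DualGroup G)) [Finite V] {A : Set G}
    {c : ℝ}
    (hc : c ≤ Int.fract (μ.real A * Nat.card V) * (1 - Int.fract (μ.real A * Nat.card V))) :
    ∃ x : G, c / Nat.card V ≤ Nat.card V * μ.real (A ∩ annCoset V x) ∧
      Nat.card V * μ.real (A ∩ annCoset V x) ≤ 1 - c / Nat.card V := by
  classical
  have hN : (0 : ℝ) < Nat.card V := by exact_mod_cast Nat.card_pos
  set N : ℝ := (Nat.card V : ℝ)
  by_contra! hno
  -- The cosets of `V^⊥` are the fibres of `e`.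
  let e : G → V → Prop := fun x v => realChar (v : DualGroup G) x = 1
  have he : ∀ x, e ⁻¹' {e x} = annCoset V x := by
    intro x
    ext y
    simp only [Set.mem_preimage, Set.mem_singleton_iff, annCoset, Set.mem_ofPred_eq]
    constructor
    · intro h v hv
      have h1 : (realChar v y = 1) = (realChar v x = 1) := congrFun h ⟨v, hv⟩
      rcases realChar_eq_or v x with h2 | h2 <;> rcases realChar_eq_or v y with h3 | h3
      · rw [h2, h3]
      · rw [h2, h3] at h1; norm_num at h1
      · rw [h2, h3] at h1; norm_num at h1
      · rw [h2, h3]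
    · intro h
      funext v
      show (realChar (v : DualGroup G) y = 1) = (realChar (v : DualGroup G) x = 1)
      rw [h v v.2]
  let R : Finset (V → Prop) := (Set.toFinite (Set.range e)).toFinset
  have hRe : ∀ t ∈ R, ∃ x, e x = t := fun t ht => by simpa [R] using ht
  choose! ξ hξ using hRe
  have hfib : ∀ t ∈ R, e ⁻¹' {t} = annCoset V (ξ t) := fun t ht => by rw [← he, hξ t ht]
  have hsum : ∀ S : Set G, ∑ t ∈ R, μ.real (S ∩ e ⁻¹' {t}) = μ.real S := by
    intro S
    have hmeas : ∀ t ∈ R, MeasurableSet (e ⁻¹' {t}) := by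
      intro t ht
      rw [hfib t ht]
      exact (isClosed_annCoset V _).measurableSet
    have h1 := sum_measureReal_preimage_singleton (μ := μ.restrict S) R hmeas
    have h2 : e ⁻¹' (R : Set (V → Prop)) = Set.univ := by
      ext x
      simp [R]
    rw [h2, measureReal_restrict_apply_univ] at h1
    rw [← h1]
    refine Finset.sum_congr rfl fun t ht => ?_
    rw [measureReal_restrict_apply (hmeas t ht), Set.inter_comm]
  have hcard : (R.card : ℝ) = N := by
    have h1 := hsum Set.univ
    have h2 : ∀ t ∈ R, μ.real (Set.univ ∩ e ⁻¹' {t}) = N⁻¹ := fun t ht => by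
      rw [Set.univ_inter, hfib t ht, measureReal_annCoset]
    rw [Finset.sum_congr rfl h2, Finset.sum_const, nsmul_eq_mul, probReal_univ] at h1
    field_simp at h1
    linarith
  have hR : R.Nonempty := by
    rw [← Finset.card_pos]
    have : (0 : ℝ) < R.card := by rw [hcard]; exact hN
    exact_mod_cast this
  let δ : (V → Prop) → ℝ := fun t => N * μ.real (A ∩ e ⁻¹' {t})
  have hδ : ∑ t ∈ R, δ t = μ.real A * N := by
    simp only [δ]
    rw [← Finset.mul_sum, hsum, mul_comm]
  have hround : ∀ t ∈ R, |δ t - (if c / N ≤ δ t then 1 else 0)| < c / N := by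
    intro t ht
    have h0 : 0 ≤ δ t := by positivity
    have h1 : δ t ≤ 1 := by
      have : μ.real (A ∩ e ⁻¹' {t}) ≤ N⁻¹ := by
        rw [← measureReal_annCoset (μ := μ) V (ξ t), ← hfib t ht]
        exact measureReal_mono Set.inter_subset_right
      calc δ t ≤ N * N⁻¹ := mul_le_mul_of_nonneg_left this hN.le
        _ = 1 := mul_inv_cancel₀ hN.ne'
    split_ifs with h
    · have h2 : 1 - c / N < δ t := by
        have := hno (ξ t)
        rw [← hfib t ht] at this
        exact this h
      rw [abs_lt]
      constructor <;> linarith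
    · rw [sub_zero, abs_of_nonneg h0]
      exact not_le.1 h
  have hlt : |μ.real A * N - ((R.filter fun t => c / N ≤ δ t).card : ℤ)| < c := by
    have h1 : (((R.filter fun t => c / N ≤ δ t).card : ℤ) : ℝ)
        = ∑ t ∈ R, (if c / N ≤ δ t then (1 : ℝ) else 0) := by
      rw [Finset.sum_ite]; simp
    rw [h1, ← hδ, ← Finset.sum_sub_distrib]
    calc _ ≤ ∑ t ∈ R, |δ t - (if c / N ≤ δ t then (1 : ℝ) else 0)| :=
          Finset.abs_sum_le_sum_abs _ _
      _ < ∑ _t ∈ R, c / N := Finset.sum_lt_sum_of_nonempty hR hround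
      _ = c := by rw [Finset.sum_const, nsmul_eq_mul, hcard]; field_simp
  exact absurd (hc.trans (fract_mul_one_sub_fract_le _ _)) (not_le.2 hlt)

/-- If `|V| μ(A)` is not close to an integer, then some coset of `V^⊥` is split by `A` into two
parts, the smaller of which is not too small. -/
theorem exists_split_annCoset (V : Subgroup (DualGroup G)) [Finite V] {A : Set G}
    (hA : MeasurableSet A) {c : ℝ}
    (hc : c ≤ Int.fract (μ.real A * Nat.card V) * (1 - Int.fract (μ.real A * Nat.card V))) :
    ∃ (x : G) (B : Set G), (B = A ∩ annCoset V x ∨ B = annCoset V x \ A) ∧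
      c / Nat.card V ≤ Nat.card V * μ.real B ∧ Nat.card V * μ.real B ≤ 1 / 2 := by
  have hN : (0 : ℝ) < Nat.card V := by exact_mod_cast Nat.card_pos
  obtain ⟨x, h1, h2⟩ := exists_annCoset_density V hc
  have h3 : μ.real (A ∩ annCoset V x) + μ.real (annCoset V x \ A) = (Nat.card V : ℝ)⁻¹ := by
    rw [← measureReal_annCoset (μ := μ) V x, Set.inter_comm, measureReal_inter_add_sdiff hA]
  have h4 : Nat.card V * μ.real (A ∩ annCoset V x) + Nat.card V * μ.real (annCoset V x \ A)
      = 1 := by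
    rw [← mul_add, h3, mul_inv_cancel₀ hN.ne']
  rcases le_total (Nat.card V * μ.real (A ∩ annCoset V x)) (1 / 2) with h | h
  · exact ⟨x, _, Or.inl rfl, h1, h⟩
  · exact ⟨x, _, Or.inr rfl, by linarith, by linarith⟩

end CosetDensity

/-! ### Iteration -/

section Iteration

variable {G : Type*} [AddCommGroup G] [TopologicalSpace G] [Module (ZMod 2) G]
  [MeasurableSpace G] {μ : Measure G}

lemma enorm_fourierAt_indicator {A : Set G} (hA : MeasurableSet A) (γ : DualGroup G) :
    ‖fourierAt μ (A.indicator fun _ => (1 : ℂ)) γ‖ₑ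
      = ENNReal.ofReal |∫ y in A, realChar γ y ∂μ| := by
  have h : fourierAt μ (A.indicator fun _ => (1 : ℂ)) γ
      = ((∫ y in A, realChar γ y ∂μ : ℝ) : ℂ) := by
    rw [fourierAt, ← integral_indicator hA, ← integral_complex_ofReal]
    congr 1
    ext y
    by_cases hy : y ∈ A <;> simp [hy, ← ofReal_realChar]
  rw [h, ← ofReal_norm, Complex.norm_real, Real.norm_eq_abs]

lemma sum_abs_setIntegral_le_algNorm {A : Set G} (hA : MeasurableSet A)
    (T : Finset (DualGroup G)) :
    ENNReal.ofReal (∑ γ ∈ T, |∫ y in A, realChar γ y ∂μ|)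
      ≤ algNorm μ (A.indicator fun _ => (1 : ℂ)) := by
  rw [ENNReal.ofReal_sum_of_nonneg fun _ _ => abs_nonneg _]
  calc _ = ∑ γ ∈ T, ‖fourierAt μ (A.indicator fun _ => (1 : ℂ)) γ‖ₑ :=
        Finset.sum_congr rfl fun γ _ => (enorm_fourierAt_indicator hA γ).symm
    _ ≤ _ := ENNReal.sum_le_tsum T

variable [BorelSpace G] [IsProbabilityMeasure μ] [IsTopologicalAddGroup G] [CompactSpace G]
  [T2Space G] [μ.IsAddLeftInvariant] [μ.WeaklyRegular]

/-- One step of the iteration. With `D = log |V| + 1 + |log c|` as the measure of size of `V`,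
the increase of `log D` is at most `64` times the increase of the `ℓ¹` norm. -/
theorem exists_subgroup_log_log_card_le (V : Subgroup (DualGroup G)) [Finite V] {A : Set G}
    (hA : MeasurableSet A) {c : ℝ} (hc0 : 0 < c)
    (hc : c ≤ Int.fract (μ.real A * Nat.card V) * (1 - Int.fract (μ.real A * Nat.card V))) :
    ∃ W : Subgroup (DualGroup G), V ≤ W ∧ Finite W ∧
      ∀ T : Finset (DualGroup G), (∀ γ, γ ∈ T ↔ γ ∈ W ∧ γ ∉ V) →
        1 / 16 ≤ ∑ γ ∈ T, |∫ y in A, realChar γ y ∂μ| ∧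
        Real.log (Real.log (Nat.card W) + (1 + |Real.log c|))
          ≤ Real.log (Real.log (Nat.card V) + (1 + |Real.log c|))
            + 64 * ∑ γ ∈ T, |∫ y in A, realChar γ y ∂μ| := by
  obtain ⟨x, B, hB, hB1, hB2⟩ := exists_split_annCoset V hA hc
  have hNnat : 0 < Nat.card V := Nat.card_pos
  have hN : (0 : ℝ) < Nat.card V := by exact_mod_cast hNnat
  have hNB : 0 < Nat.card V * μ.real B := lt_of_lt_of_le (by positivity) hB1
  have hB0 : 0 < μ.real B := pos_of_mul_pos_right hNB hN.le
  obtain ⟨k, n, W, hVW, hWfin, hcard, hn, hT⟩ := exists_subgroup_weight_gain V hA hB hB0 hB2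
  refine ⟨W, hVW, hWfin, fun T hTW => ?_⟩
  have hgain := hT T hTW
  set S := ∑ γ ∈ T, |∫ y in A, realChar γ y ∂μ|
  set D := Real.log (Nat.card V) + (1 + |Real.log c|) with hD
  have hlogV : 0 ≤ Real.log (Nat.card V) := Real.log_natCast_nonneg _
  have hD1 : 1 ≤ D := by have := abs_nonneg (Real.log c); linarith
  have hk0 : (0 : ℝ) ≤ k := Nat.cast_nonneg k
  refine ⟨by linarith, ?_⟩
  have hlog : Real.log (1 / (Nat.card V * μ.real B)) ≤ D := by
    calc Real.log (1 / (Nat.card V * μ.real B)) ≤ Real.log (Nat.card V / c) := by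
          refine Real.log_le_log (by positivity) ?_
          rw [div_le_div_iff₀ hNB hc0]
          rw [div_le_iff₀ hN] at hB1
          linarith
      _ = Real.log (Nat.card V) - Real.log c := Real.log_div hN.ne' hc0.ne'
      _ ≤ D := by have := neg_abs_le (Real.log c); linarith
  have hWnat : 0 < Nat.card W := Nat.card_pos
  have hlogW0 : 0 ≤ Real.log (Nat.card W) := Real.log_natCast_nonneg _
  have hlogW : Real.log (Nat.card W) ≤ Real.log (Nat.card V) + n := by
    have h1 : (Nat.card W : ℝ) ≤ Nat.card V * 2 ^ n := by exact_mod_cast hcard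
    have h2 := Real.log_le_log (by exact_mod_cast hWnat) h1
    rw [Real.log_mul hN.ne' (by positivity), Real.log_pow] at h2
    have h3 : (n : ℝ) * Real.log 2 ≤ n * 1 :=
      mul_le_mul_of_nonneg_left (by have := Real.log_two_lt_d9; linarith) (Nat.cast_nonneg n)
    linarith
  have hDW : Real.log (Nat.card W) + (1 + |Real.log c|) ≤ 4 ^ (k + 2) * D := by
    have h1 : (n : ℝ) ≤ 2 * 4 ^ (k + 1) * D :=
      hn.trans (mul_le_mul_of_nonneg_left hlog (by positivity))
    have h2 : (1 : ℝ) ≤ 4 ^ (k + 1) := one_le_pow₀ (by norm_num)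
    have h3 : (4 : ℝ) ^ (k + 2) = 4 * 4 ^ (k + 1) := by ring
    rw [h3]
    nlinarith
  have hlog4 : Real.log 4 ≤ 2 := by
    have h4 : (4 : ℝ) = 2 ^ 2 := by norm_num
    rw [h4, Real.log_pow]
    have := Real.log_two_lt_d9
    push_cast
    linarith
  have hc1 := abs_nonneg (Real.log c)
  calc Real.log (Real.log (Nat.card W) + (1 + |Real.log c|))
      ≤ Real.log (4 ^ (k + 2) * D) := Real.log_le_log (by linarith) hDW
    _ = ((k + 2 : ℕ) : ℝ) * Real.log 4 + Real.log D := by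
        rw [Real.log_mul (by positivity) (by linarith), Real.log_pow]
    _ ≤ ((k + 2 : ℕ) : ℝ) * 2 + Real.log D := by
        have := mul_le_mul_of_nonneg_left hlog4 (Nat.cast_nonneg (α := ℝ) (k + 2))
        linarith
    _ ≤ Real.log D + 64 * S := by
        push_cast
        linarith

/-- The iteration: as long as the hypothesis on `|V| μ(A)` is available, the `ℓ¹` norm carried by
the finite groups grows by at least `1 / 16` in each step. -/
lemma log_log_le_of_forall_sum_le {A : Set G} (hA : MeasurableSet A) {c M K : ℝ} (hc0 : 0 < c)
    (hM : 1 < M)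
    (hV : ∀ V : Subgroup (DualGroup G), Finite V → (Nat.card V : ℝ) ≤ M →
      c ≤ Int.fract (μ.real A * Nat.card V) * (1 - Int.fract (μ.real A * Nat.card V)))
    (hK : ∀ T : Finset (DualGroup G), ∑ γ ∈ T, |∫ y in A, realChar γ y ∂μ| ≤ K) :
    1 / 16 ≤ K ∧ Real.log (Real.log M) ≤ Real.log (1 + |Real.log c|) + 64 * K := by
  classical
  have hc1 := abs_nonneg (Real.log c)
  have key : ∀ n : ℕ, ∃ (V : Subgroup (DualGroup G)) (T : Finset (DualGroup G)), Finite V ∧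
      (∀ γ ∈ T, γ ∈ V) ∧
      Real.log (Real.log (Nat.card V) + (1 + |Real.log c|)) ≤ Real.log (1 + |Real.log c|)
        + 64 * ∑ γ ∈ T, |∫ y in A, realChar γ y ∂μ| ∧
      ((n : ℝ) / 16 ≤ ∑ γ ∈ T, |∫ y in A, realChar γ y ∂μ| ∨ M < Nat.card V) ∧
      (M < Nat.card V → 1 / 16 ≤ ∑ γ ∈ T, |∫ y in A, realChar γ y ∂μ|) := by
    intro n
    induction n with
    | zero => exact ⟨⊥, ∅, inferInstance, by simp, by simp, Or.inl (by simp),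
        fun h => absurd h (by simpa using hM.le)⟩
    | succ n ih =>
      obtain ⟨V, T, hfin, hTV, hlog, h, hV1⟩ := ih
      by_cases hVM : (Nat.card V : ℝ) ≤ M
      · obtain ⟨W, hVW, hWfin, hW⟩ := exists_subgroup_log_log_card_le V hA hc0 (hV V hfin hVM)
        have hWV : {γ | γ ∈ W ∧ γ ∉ V}.Finite :=
          (Set.toFinite (W : Set (DualGroup G))).subset fun γ h => h.1
        obtain ⟨h1, h2⟩ := hW hWV.toFinset (fun γ => by simp)
        have hdisj : Disjoint T hWV.toFinset := by
          rw [Finset.disjoint_left]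
          intro γ h3 h4
          exact (hWV.mem_toFinset.1 h4).2 (hTV γ h3)
        have hT0 : 0 ≤ ∑ γ ∈ T, |∫ y in A, realChar γ y ∂μ| :=
          Finset.sum_nonneg fun _ _ => abs_nonneg _
        refine ⟨W, T ∪ hWV.toFinset, hWfin, ?_, ?_, Or.inl ?_, fun _ => ?_⟩
        · intro γ hγ
          rcases Finset.mem_union.1 hγ with h3 | h3
          · exact hVW (hTV γ h3)
          · exact (hWV.mem_toFinset.1 h3).1
        · rw [Finset.sum_union hdisj]
          linarith
        · rw [Finset.sum_union hdisj]
          push_cast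
          rcases h with h | h
          · linarith
          · exact absurd hVM (not_le.2 h)
        · rw [Finset.sum_union hdisj]
          linarith
      · exact ⟨V, T, hfin, hTV, hlog, Or.inr (not_le.1 hVM), hV1⟩
  -- So many steps would exceed `K`, hence the size of the group exceeds `M` before.
  obtain ⟨n, hn⟩ := exists_nat_gt (16 * K)
  obtain ⟨V, T, hfin, -, hlog, h, hV1⟩ := key n
  have hT := hK T
  rcases h with h | h1
  · linarith
  · refine ⟨(hV1 h1).trans hT, ?_⟩
    have h3 : Real.log M ≤ Real.log (Nat.card V) := Real.log_le_log (by linarith) h1.le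
    have h4 : Real.log (Real.log M) ≤ Real.log (Real.log (Nat.card V) + (1 + |Real.log c|)) :=
      Real.log_le_log (Real.log_pos hM) (by linarith)
    linarith

end Iteration

/-! ### The lower bound -/

theorem theorem2p3 (c : ℝ) (hc : 0 < c) :
    ∃ C : ℝ, 0 < C ∧
      ∀ (G : Type*) [AddCommGroup G] [Module (ZMod 2) G] [TopologicalSpace G]
        [IsTopologicalAddGroup G] [CompactSpace G] [T2Space G]
        [MeasurableSpace G] [BorelSpace G]
        (μ : Measure G) [μ.IsAddHaarMeasure] [μ.Regular] [IsProbabilityMeasure μ]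
        (A : Set G) (_hA : NullMeasurableSet A μ) (α : ℝ) (_hα : μ.real A = α)
        (M : ℝ) (_hM : 1 < M)
        (_hV : ∀ V : Subgroup (DualGroup G), Finite V → (Nat.card V : ℝ) ≤ M →
          c ≤ Int.fract (α * (Nat.card V : ℝ)) * (1 - Int.fract (α * (Nat.card V : ℝ)))),
        ENNReal.ofReal (C * Real.log (Real.log M)) ≤
          algNorm μ (A.indicator (fun _ => (1 : ℂ))) := by
  have hc1 := abs_nonneg (Real.log c)
  have hL : 0 ≤ Real.log (1 + |Real.log c|) := Real.log_nonneg (by linarith)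
  refine ⟨1 / (16 * Real.log (1 + |Real.log c|) + 64), by positivity, ?_⟩
  intro G _ _ _ _ _ _ _ _ μ _ _ _ A hA α hα M hM hV
  obtain ⟨A', -, hA', hAA'⟩ := hA.exists_measurable_superset_ae_eq
  have hnorm : algNorm μ (A.indicator fun _ => (1 : ℂ))
      = algNorm μ (A'.indicator fun _ => (1 : ℂ)) := by
    unfold algNorm fourierAt
    congr 1
    ext γ
    congr 1
    refine integral_congr_ae ?_
    filter_upwards [indicator_ae_eq_of_ae_eq_set (f := fun _ => (1 : ℂ)) hAA'] with y hy
    rw [hy]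
  subst hα
  rw [← measureReal_congr hAA'] at hV
  rw [hnorm]
  by_cases htop : algNorm μ (A'.indicator fun _ => (1 : ℂ)) = ⊤
  · rw [htop]; exact le_top
  obtain ⟨h1, h2⟩ := log_log_le_of_forall_sum_le hA' hc hM hV
    (K := (algNorm μ (A'.indicator fun _ => (1 : ℂ))).toReal)
    (fun T => (ENNReal.ofReal_le_iff_le_toReal htop).1 (sum_abs_setIntegral_le_algNorm hA' T))
  rw [ENNReal.ofReal_le_iff_le_toReal htop, one_div_mul_eq_div, div_le_iff₀ (by positivity)]
  nlinarith
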